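/- For complex parameters $\eta,\kappa,\lambda,g_2,g_3$ consider the differential equation $$(\Sigma'')^2-\eta\,(z\Sigma'-\Sigma)^2+2(\kappa\Sigma'-\lambda)(z\Sigma'-\Sigma)+4(\Sigma')^3-g_2\Sigma'+g_3=0 \qquad (*)$$ for a meromorphic function $\Sigma$ on a nonempty connected open set $U\subseteq\mathbb C$ (for example $U=\mathbb C$). Equalities between meromorphic functions are understood off a discrete set. By a nontrivial solution we mean a solution that is not of the form $az+b$ with constants $a,b$. (1) If $\eta=\kappa=0$ and $\lambda\neq0$, then for every nontrivial solution $\Sigma$ of $(*)$ the function $w=-\Sigma'$ satisfies the first Painlevé equation in the form $$w''=6w^2-\lambda z-\tfrac12 g_2$$ at every point of $U$ at which $\Sigma$ is analytic. (2) If $\eta=\kappa=\lambda=0$, then the nontrivial solutions of $(*)$ are exactly the functions $$\Sigma(z)=\zeta(z-z_0;g_2,g_3)+B,\qquad z_0,B\in\mathbb C,$$ where $\zeta(\cdot\,;g_2,g_3)$ is the Weierstrass zeta function with invariants $g_2,g_3$, and for such $\Sigma$ one has $\Sigma'(z)=-\wp(z-z_0;g_2,g_3)$. If $g_2^3-27g_3^2\neq0$,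 there is a lattice in $\mathbb C$ with invariants $g_2,g_3$, the functions $\zeta$ and $\wp$ are those of any such lattice, and $\Sigma'=-\wp(z-z_0;g_2,g_3)$ is (the restriction to $U$ of) an elliptic function. If $g_2^3-27g_3^2=0$, there is $k\in\mathbb C$ with $g_2=\tfrac43k^4$, $g_3=-\tfrac8{27}k^6$, and for any such $k$ the functions $\zeta,\wp$ are the degenerate ones, $\zeta(z)=k\coth(kz)-\tfrac{k^2}{3}z$ and $\wp(z)=\tfrac{k^2}{3}+\frac{k^2}{\sinh^2(kz)}$ if $k\ne0$, and $\zeta(z)=1/z$, $\wp(z)=1/z^2$ if $k=0$. -/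

import Mathlib

open Filter

/-- The left-hand side of the shifted sigma equation at the point `z`:
`(S'')² - η (z S' - S)² + 2 (κ S' - λ) (z S' - S) + 4 (S')³ - g₂ S' + g₃`. -/
noncomputable def sigmaLHS (η κ lam g₂ g₃ : ℂ) (S : ℂ → ℂ) (z : ℂ) : ℂ :=
  (deriv (deriv S) z) ^ 2 - η * (z * deriv S z - S z) ^ 2
    + 2 * (κ * deriv S z - lam) * (z * deriv S z - S z)
    + 4 * (deriv S z) ^ 3 - g₂ * deriv S z + g₃

/-- `S` is a meromorphic solution of the shifted sigma equation on `U`. A meromorphic function in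
Mathlib is only meaningful off a discrete set (the points where it fails to be analytic), so the
equation is imposed exactly at the points of `U` where `S` is analytic. -/
structure IsSigmaSolution (η κ lam g₂ g₃ : ℂ) (U : Set ℂ) (S : ℂ → ℂ) : Prop where
  meromorphicOn : MeromorphicOn S U
  equation : ∀ z ∈ U, AnalyticAt ℂ S z → sigmaLHS η κ lam g₂ g₃ S z = 0

/-- `S` is one of the trivial functions `a z + b` on `U` (up to values on a discrete set). -/
def IsAffineOn (U : Set ℂ) (S : ℂ → ℂ) : Prop :=
  ∃ a b : ℂ, S =ᶠ[codiscreteWithin U] fun z => a * z + b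

/-- The Weierstrass zeta function of a lattice,
`ζ(z) = 1/z + ∑_{l ≠ 0} (1/(z - l) + 1/l + z/l²)`.
The term of the sum below with `l = 0` is `1/z`, because `1/0 = 0` and `z/0 = 0`. -/
noncomputable def PeriodPair.weierstrassZeta (L : PeriodPair) (z : ℂ) : ℂ :=
  ∑' l : L.lattice, (1 / (z - l) + 1 / (l : ℂ) + z / (l : ℂ) ^ 2)

/-- The Weierstrass zeta function with invariants `g₂ = 4k⁴/3`, `g₃ = -8k⁶/27`, which are
the invariants of vanishing discriminant: `k coth(k z) - k² z / 3`, and `1/z` for `k = 0`. -/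
noncomputable def degenerateZeta (k z : ℂ) : ℂ :=
  if k = 0 then 1 / z
  else k * Complex.cosh (k * z) / Complex.sinh (k * z) - k ^ 2 * z / 3

/-- The Weierstrass `℘` function with invariants `g₂ = 4k⁴/3`, `g₃ = -8k⁶/27`:
`k²/3 + k²/sinh²(k z)`, and `1/z²` for `k = 0`. -/
noncomputable def degenerateP (k z : ℂ) : ℂ :=
  if k = 0 then 1 / z ^ 2
  else k ^ 2 / 3 + k ^ 2 / Complex.sinh (k * z) ^ 2

/-- Elliptic functions: meromorphic on the whole plane and doubly periodic. -/
def IsElliptic (f : ℂ → ℂ) : Prop :=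
  MeromorphicOn f Set.univ ∧ ∃ L : PeriodPair, ∀ l ∈ L.lattice, Function.Periodic f l

/-!
Differentiating the sigma equation with `η = κ = 0` gives `2 S'' F = 0`, where
`F = S''' - λ z + 6 (S')² - g₂ / 2`. If `S''` vanished near some point, `S` would be affine near that
point, hence affine on all of the connected set by the identity theorem; so a nontrivial solution
satisfies `F = 0` (`deriv_three_of_sigmaLHS_eq_zero`). For `w = -S'` this is the first Painlevé
equation.

For `λ = 0` all that matters about `(ζ, ℘)`, both for a lattice and in the degenerate case, is
collected in `IsWeierstrassPair`: `ζ' = -℘`, the Weierstrass equation for `℘`, the presence of a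
pole, and the fact that every point `(c, d)` of the curve `d² = 4 c³ - g₂ c - g₃` with `d ≠ 0` is of
the form `(℘(u), ℘'(u))`. Translates of `ζ` are then solutions, and they are not affine because of
the pole. Conversely, given a nontrivial solution `S`, choose a point `p` with `S''(p) ≠ 0` and a
translate of `ζ` whose first two derivatives at `p` agree with those of `S`. The difference `f` of
the first derivatives satisfies a linear equation `f'' = h f` with `f(p) = f'(p) = 0`, so it vanishes
near `p` (`AnalyticAt.eventually_eq_zero_of_deriv_deriv_eq_mul`), and the identity theorem gives
`S = ζ(z - z₀) + B` on the whole set.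

For a lattice, the points of the curve are attained because an elliptic function `℘` omitting a
value `c` would make `1 / (℘ - c)` a bounded entire function (`PeriodPair.exists_weierstrassP_eq`).
In the degenerate case the curve is parametrised by elementary functions.

That every `(g₂, g₃)` of nonzero discriminant comes from a lattice is a statement about level one
modular forms. The form `27 g₃² E₄³ - g₂³ E₆²` of weight `12` is nonzero at the cusp, so it has a zero
`τ` in the upper half plane, because otherwise its inverse would be a nonzero modular form of
negative weight (`ModularForm.exists_apply_eq_zero_of_levelOne`). The lattice `ℤ τ + ℤ` then has the
right ratio `g₂³ : g₃²`, the values `E₄(τ)` and `E₆(τ)` do not both vanish because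
`E₄³ - E₆² = 1728 Δ`, and a homothety gives the invariants themselves
(`PeriodPair.exists_g₂_eq_g₃_eq`).
-/

open scoped Topology

/-! ### Identity principles -/

theorem eventuallyEq_codiscreteWithin_iff {U : Set ℂ} (hU : IsOpen U) {f g : ℂ → ℂ} :
    f =ᶠ[codiscreteWithin U] g ↔ ∀ x ∈ U, f =ᶠ[𝓝[≠] x] g := by
  rw [EventuallyEq, Filter.Eventually, mem_codiscreteWithin_iff_forall_mem_nhdsNE]
  refine forall₂_congr fun x hx => ⟨fun h => ?_, fun h => ?_⟩
  · filter_upwards [h, mem_nhdsWithin_of_mem_nhds (hU.mem_nhds hx)] with y hy hyU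
    exact hy.resolve_right (fun h => h hyU)
  · filter_upwards [h] with y hy using Or.inl hy

/-- The identity theorem for meromorphic functions on a connected open set. -/
theorem MeromorphicOn.eventuallyEq_codiscreteWithin {U : Set ℂ} (hUo : IsOpen U)
    (hUc : IsPreconnected U) {f g : ℂ → ℂ} (hf : MeromorphicOn f U) (hg : MeromorphicOn g U)
    {p : ℂ} (hp : p ∈ U) (h : f =ᶠ[𝓝[≠] p] g) : f =ᶠ[codiscreteWithin U] g := by
  rw [eventuallyEq_codiscreteWithin_iff hUo]
  intro x hx
  have h0 : meromorphicOrderAt (f - g) p = ⊤ := by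
    rw [meromorphicOrderAt_eq_top_iff]
    filter_upwards [h] with y hy
    simp [hy]
  have h1 : meromorphicOrderAt (f - g) x = ⊤ := by
    by_contra hne
    exact (hf.sub hg).meromorphicOrderAt_ne_top_of_isPreconnected hUc hx hp hne h0
  rw [meromorphicOrderAt_eq_top_iff] at h1
  filter_upwards [h1] with y hy
  simpa [sub_eq_zero] using hy

/-- Uniqueness for the linear equation `f'' = h f`: with vanishing initial data, `f''` would vanish
to order two less than `f`, but `h f` vanishes at least to the order of `f`. -/
theorem AnalyticAt.eventually_eq_zero_of_deriv_deriv_eq_mul {f h : ℂ → ℂ} {p : ℂ}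
    (hf : AnalyticAt ℂ f p) (hh : AnalyticAt ℂ h p)
    (hode : deriv (deriv f) =ᶠ[𝓝 p] h * f) (h0 : f p = 0) (h1 : deriv f p = 0) :
    ∀ᶠ z in 𝓝 p, f z = 0 := by
  rw [← analyticOrderAt_eq_top]
  have e1 := hf.analyticOrderAt_deriv_add_one
  have e2 := hf.deriv.analyticOrderAt_deriv_add_one
  rw [analyticOrderAt_congr hode, analyticOrderAt_mul hh hf] at e2
  simp only [h0, h1, sub_zero] at e1 e2
  change _ = analyticOrderAt f p at e1
  change _ = analyticOrderAt (deriv f) p at e2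
  rw [← e2] at e1
  by_contra hne
  lift analyticOrderAt f p to ℕ using hne with n
  cases hm : analyticOrderAt h p with
  | top => rw [hm] at e1; simp at e1
  | coe m =>
    rw [hm] at e1
    norm_cast at e1
    omega

/-- An analytic function with vanishing derivative near a point is constant near it. -/
theorem AnalyticAt.eventually_eq_of_deriv_eq_zero {f : ℂ → ℂ} {p : ℂ} (hf : AnalyticAt ℂ f p)
    (h : ∀ᶠ z in 𝓝 p, deriv f z = 0) : ∀ᶠ z in 𝓝 p, f z = f p := by
  have e := hf.analyticOrderAt_deriv_add_one
  rw [analyticOrderAt_eq_top.mpr h, top_add] at e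
  filter_upwards [analyticOrderAt_eq_top.mp e.symm] with z hz using sub_eq_zero.mp hz

/-! ### The sigma equation -/

/-- The second order equation obtained by differentiating the sigma equation (with `η = κ = 0`) and
cancelling `S''`, which is possible as long as `S` is not affine near the point. -/
theorem deriv_three_of_sigmaLHS_eq_zero {lam g₂ g₃ : ℂ} {S : ℂ → ℂ} {z : ℂ}
    (hS : AnalyticAt ℂ S z) (heq : ∀ᶠ x in 𝓝 z, sigmaLHS 0 0 lam g₂ g₃ S x = 0)
    (hne : ¬ ∀ᶠ x in 𝓝 z, deriv (deriv S) x = 0) :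
    ∀ᶠ x in 𝓝 z,
      deriv (deriv (deriv S)) x = lam * x - 6 * deriv S x ^ 2 + g₂ / 2 := by
  set F : ℂ → ℂ := fun x => deriv (deriv (deriv S)) x - (lam * x - 6 * deriv S x ^ 2 + g₂ / 2)
    with hF
  have hFan : AnalyticAt ℂ F z := by
    have h1 := hS.deriv
    have h3 := hS.deriv.deriv.deriv
    fun_prop
  -- the derivative of the left-hand side is `2 S'' F`
  have hprod : ∀ᶠ x in 𝓝 z, deriv (deriv S) x * F x = 0 := by
    filter_upwards [heq.eventually_nhds, hS.eventually_analyticAt] with x hx hSx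
    have d0 := hSx.differentiableAt.hasDerivAt
    have d1 := hSx.deriv.differentiableAt.hasDerivAt
    have d2 := hSx.deriv.deriv.differentiableAt.hasDerivAt
    have hd : HasDerivAt (fun x => sigmaLHS 0 0 lam g₂ g₃ S x)
        (2 * (deriv (deriv S) x * F x)) x := by
      have := ((((d2.pow 2).add ((((hasDerivAt_id x).mul d1).sub d0).const_mul (-2 * lam))).add
        ((d1.pow 3).const_mul 4)).sub (d1.const_mul g₂)).add_const g₃
      refine (this.congr_deriv ?_).congr_of_eventuallyEq (.of_forall fun y => ?_)
      · simp [hF]; ring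
      · simp [sigmaLHS]
    have hz : HasDerivAt (fun x => sigmaLHS 0 0 lam g₂ g₃ S x) 0 x :=
      (hasDerivAt_const x (0 : ℂ)).congr_of_eventuallyEq (by filter_upwards [hx] with y hy using hy)
    simpa using hd.unique hz
  have hnz := hS.deriv.deriv.eventually_eq_zero_or_eventually_ne_zero.resolve_left hne
  have hF0 : ∀ᶠ x in 𝓝[≠] z, F x = 0 := by
    filter_upwards [hnz, hprod.filter_mono nhdsWithin_le_nhds] with x hx hx'
    exact (mul_eq_zero.mp hx').resolve_left hx
  filter_upwards [hFan.frequently_zero_iff_eventually_zero.mp hF0.frequently] with x hx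
  exact sub_eq_zero.mp hx

theorem IsSigmaSolution.eventually_sigmaLHS_eq_zero {η κ lam g₂ g₃ : ℂ} {U : Set ℂ} {S : ℂ → ℂ}
    (hUo : IsOpen U) (h : IsSigmaSolution η κ lam g₂ g₃ U S) {z : ℂ} (hz : z ∈ U)
    (hS : AnalyticAt ℂ S z) : ∀ᶠ x in 𝓝 z, sigmaLHS η κ lam g₂ g₃ S x = 0 := by
  filter_upwards [hUo.mem_nhds hz, hS.eventually_analyticAt] with x hx hSx
  exact h.equation x hx hSx

theorem isAffineOn_of_deriv_deriv_eq_zero {U : Set ℂ} (hUo : IsOpen U) (hUc : IsPreconnected U)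
    {S : ℂ → ℂ} (hm : MeromorphicOn S U) {z : ℂ} (hz : z ∈ U) (hS : AnalyticAt ℂ S z)
    (h : ∀ᶠ x in 𝓝 z, deriv (deriv S) x = 0) : IsAffineOn U S := by
  have h1 := hS.deriv.eventually_eq_of_deriv_eq_zero h
  have h2 : ∀ᶠ x in 𝓝 z, deriv (fun y => S y - deriv S z * y) x = 0 := by
    filter_upwards [h1, hS.eventually_analyticAt] with x hx hSx
    rw [deriv_fun_sub hSx.differentiableAt (by fun_prop)]
    simp [hx]
  have h3 := AnalyticAt.eventually_eq_of_deriv_eq_zero (by fun_prop) h2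
  refine ⟨deriv S z, S z - deriv S z * z,
    hm.eventuallyEq_codiscreteWithin hUo hUc (fun x _ => ?_) hz ?_⟩
  · have : AnalyticAt ℂ (fun x => deriv S z * x + (S z - deriv S z * z)) x := by fun_prop
    exact this.meromorphicAt
  · filter_upwards [h3.filter_mono nhdsWithin_le_nhds] with x hx
    linear_combination hx

/-- With `w = -S'`, the differentiated sigma equation is the first Painlevé equation. -/
theorem IsSigmaSolution.painleve_one {lam g₂ g₃ : ℂ} {U : Set ℂ} (hUo : IsOpen U)
    (hUc : IsConnected U) {S : ℂ → ℂ} (h : IsSigmaSolution 0 0 lam g₂ g₃ U S)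
    (hna : ¬ IsAffineOn U S) {z : ℂ} (hz : z ∈ U) (hS : AnalyticAt ℂ S z) :
    deriv (deriv fun x => -deriv S x) z = 6 * (-deriv S z) ^ 2 - lam * z - g₂ / 2 := by
  have h3 := (deriv_three_of_sigmaLHS_eq_zero hS (h.eventually_sigmaLHS_eq_zero hUo hz hS)
    fun h0 => hna (isAffineOn_of_deriv_deriv_eq_zero hUo hUc.isPreconnected
      h.meromorphicOn hz hS h0)).self_of_nhds
  have e : (deriv fun x => -deriv S x) = fun x => -deriv (deriv S) x := by
    ext x; exact deriv.fun_neg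
  rw [e, deriv.fun_neg, h3]
  ring

/-! ### Solving the autonomous equation -/

/-- The properties of a pair `(ζ, ℘)` with invariants `g₂, g₃` that determine the solutions of
`(S'')² + 4 (S')³ - g₂ S' + g₃ = 0`: away from its poles `Z` is analytic and `Z' = -P`, the
function `P` solves the Weierstrass equation, and `(P, P')` attains every point `(c, d)` with
`d ≠ 0` of the curve `d² = 4 c³ - g₂ c - g₃`. -/
structure IsWeierstrassPair (g₂ g₃ : ℂ) (Z P : ℂ → ℂ) : Prop where
  analyticAt_or_pole : ∀ u, AnalyticAt ℂ Z u ∨ meromorphicOrderAt Z u < 0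
  pole_zero : meromorphicOrderAt Z 0 < 0
  deriv_eq : ∀ u, AnalyticAt ℂ Z u → deriv Z u = -P u
  equation : ∀ u, AnalyticAt ℂ Z u → deriv P u ^ 2 = 4 * P u ^ 3 - g₂ * P u - g₃
  exists_point : ∀ c d, d ≠ 0 → d ^ 2 = 4 * c ^ 3 - g₂ * c - g₃ →
    ∃ u, AnalyticAt ℂ Z u ∧ P u = c ∧ deriv P u = d

namespace IsWeierstrassPair

variable {g₂ g₃ : ℂ} {Z P : ℂ → ℂ}

theorem meromorphic (h : IsWeierstrassPair g₂ g₃ Z P) : Meromorphic Z := fun u =>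
  (h.analyticAt_or_pole u).elim AnalyticAt.meromorphicAt fun hu =>
    meromorphicAt_of_meromorphicOrderAt_ne_zero hu.ne

theorem meromorphicAt_translate (h : IsWeierstrassPair g₂ g₃ Z P) (z₀ B x : ℂ) :
    MeromorphicAt (fun z => Z (z - z₀) + B) x :=
  ((h.meromorphic (x - z₀)).comp_analyticAt (g := fun z => z - z₀) (by fun_prop)).add
    (MeromorphicAt.const B x)

theorem analyticAt_translate {z₀ z : ℂ} (hZ : AnalyticAt ℂ Z (z - z₀)) (B : ℂ) :
    AnalyticAt ℂ (fun x => Z (x - z₀) + B) z :=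
  (hZ.comp (f := fun x => x - z₀) (by fun_prop)).add analyticAt_const

/-- A function that is analytic at `z` and agrees near `z` with a translate of `Z` does not meet a
pole of that translate. -/
theorem analyticAt_of_eventuallyEq (h : IsWeierstrassPair g₂ g₃ Z P) {z₀ B z : ℂ} {S : ℂ → ℂ}
    (hS : AnalyticAt ℂ S z) (hST : S =ᶠ[𝓝[≠] z] fun x => Z (x - z₀) + B) :
    AnalyticAt ℂ Z (z - z₀) ∧ S =ᶠ[𝓝 z] fun x => Z (x - z₀) + B := by
  have hZ : AnalyticAt ℂ Z (z - z₀) := by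
    refine (h.analyticAt_or_pole (z - z₀)).resolve_right fun hlt => ?_
    rw [← meromorphicOrderAt_comp_sub_const_eq_meromorphicOrderAt] at hlt
    have hcongr : (Z ∘ (· - z₀)) =ᶠ[𝓝[≠] z] fun x => S x - B := by
      filter_upwards [hST] with x hx
      simp [hx]
    rw [meromorphicOrderAt_congr hcongr] at hlt
    exact hlt.not_ge (hS.sub analyticAt_const).meromorphicOrderAt_nonneg
  exact ⟨hZ, (hS.frequently_eq_iff_eventually_eq (analyticAt_translate hZ B)).mp hST.frequently⟩

theorem deriv_translate (h : IsWeierstrassPair g₂ g₃ Z P) {z₀ z : ℂ}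
    (hZ : AnalyticAt ℂ Z (z - z₀)) (B : ℂ) :
    deriv (fun x => Z (x - z₀) + B) =ᶠ[𝓝 z] fun x => -P (x - z₀) := by
  have hc : ContinuousAt (fun x => x - z₀) z := by fun_prop
  filter_upwards [hc.eventually hZ.eventually_analyticAt] with x hx
  rw [deriv_add_const, deriv_comp_sub_const, h.deriv_eq _ hx]

theorem deriv_deriv_translate (h : IsWeierstrassPair g₂ g₃ Z P) {z₀ z : ℂ}
    (hZ : AnalyticAt ℂ Z (z - z₀)) (B : ℂ) :
    deriv (deriv fun x => Z (x - z₀) + B) z = -deriv P (z - z₀) := by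
  rw [(h.deriv_translate hZ B).deriv_eq, deriv.fun_neg, deriv_comp_sub_const]

theorem sigmaLHS_translate (h : IsWeierstrassPair g₂ g₃ Z P) {z₀ z : ℂ}
    (hZ : AnalyticAt ℂ Z (z - z₀)) (B : ℂ) :
    sigmaLHS 0 0 0 g₂ g₃ (fun x => Z (x - z₀) + B) z = 0 := by
  rw [sigmaLHS, h.deriv_deriv_translate hZ B, (h.deriv_translate hZ B).self_of_nhds]
  linear_combination h.equation _ hZ

theorem deriv_eq_of_eventuallyEq (h : IsWeierstrassPair g₂ g₃ Z P) {U : Set ℂ} (hUo : IsOpen U)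
    {S : ℂ → ℂ} {z₀ B : ℂ} (hST : S =ᶠ[codiscreteWithin U] fun z => Z (z - z₀) + B)
    {z : ℂ} (hz : z ∈ U) (hS : AnalyticAt ℂ S z) : deriv S z = -P (z - z₀) := by
  obtain ⟨hZ, hEq⟩ := h.analyticAt_of_eventuallyEq hS
    ((eventuallyEq_codiscreteWithin_iff hUo).mp hST z hz)
  rw [hEq.deriv_eq, (h.deriv_translate hZ B).self_of_nhds]

theorem isSigmaSolution (h : IsWeierstrassPair g₂ g₃ Z P) {U : Set ℂ} (hUo : IsOpen U)
    {S : ℂ → ℂ} {z₀ B : ℂ} (hST : S =ᶠ[codiscreteWithin U] fun z => Z (z - z₀) + B) :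
    IsSigmaSolution 0 0 0 g₂ g₃ U S where
  meromorphicOn := MeromorphicOn.congr_codiscreteWithin
    (fun x _ => h.meromorphicAt_translate z₀ B x) hST.symm hUo
  equation z hz hS := by
    obtain ⟨hZ, hEq⟩ := h.analyticAt_of_eventuallyEq hS
      ((eventuallyEq_codiscreteWithin_iff hUo).mp hST z hz)
    have hT := h.sigmaLHS_translate hZ B
    rw [sigmaLHS] at hT ⊢
    rwa [hEq.deriv.deriv_eq, hEq.deriv_eq, hEq.self_of_nhds]

/-- A translate of `Z` is not affine on any open set: it would be affine on the whole plane by the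
identity theorem, but it has a pole. -/
theorem not_isAffineOn (h : IsWeierstrassPair g₂ g₃ Z P) {U : Set ℂ} (hUo : IsOpen U)
    (hU : U.Nonempty) {S : ℂ → ℂ} {z₀ B : ℂ}
    (hST : S =ᶠ[codiscreteWithin U] fun z => Z (z - z₀) + B) : ¬ IsAffineOn U S := by
  rintro ⟨a, b, hab⟩
  obtain ⟨p, hp⟩ := hU
  have hA (x : ℂ) : AnalyticAt ℂ (fun z => a * z + b) x := by fun_prop
  have h1 := (eventuallyEq_codiscreteWithin_iff hUo).mp (hab.symm.trans hST) p hp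
  have h2 := MeromorphicOn.eventuallyEq_codiscreteWithin isOpen_univ isPreconnected_univ
    (fun x _ => (hA x).meromorphicAt) (fun x _ => h.meromorphicAt_translate z₀ B x)
    (Set.mem_univ p) h1
  have h3 := (eventuallyEq_codiscreteWithin_iff isOpen_univ).mp h2 z₀ (Set.mem_univ _)
  have h4 := (h.analyticAt_of_eventuallyEq (hA z₀) h3).1
  rw [sub_self] at h4
  exact h.pole_zero.not_ge h4.meromorphicOrderAt_nonneg

/-- Every nontrivial solution is a translate of `Z` up to a constant: choose the translation so
that the initial data agree at a point where `S'' ≠ 0`; then `S'` and the derivative of the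
translate satisfy the same second order equation with the same initial data. -/
theorem exists_eq_translate (h : IsWeierstrassPair g₂ g₃ Z P) {U : Set ℂ} (hUo : IsOpen U)
    (hUc : IsConnected U) {S : ℂ → ℂ} (hsol : IsSigmaSolution 0 0 0 g₂ g₃ U S)
    (hna : ¬ IsAffineOn U S) :
    ∃ z₀ B : ℂ, S =ᶠ[codiscreteWithin U] fun z => Z (z - z₀) + B := by
  obtain ⟨q₀, hq₀⟩ := hUc.nonempty
  obtain ⟨q, hqS, hqU⟩ := ((hsol.meromorphicOn q₀ hq₀).eventually_analyticAt.and
    (mem_nhdsWithin_of_mem_nhds (hUo.mem_nhds hq₀))).exists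
  have hqne : ∃ᶠ x in 𝓝 q, deriv (deriv S) x ≠ 0 := fun h0 =>
    hna (isAffineOn_of_deriv_deriv_eq_zero hUo hUc.isPreconnected hsol.meromorphicOn hqU hqS
      (by simpa using h0))
  obtain ⟨p, hp2, hpS, hpU⟩ :=
    (hqne.and_eventually (hqS.eventually_analyticAt.and (hUo.mem_nhds hqU))).exists
  have heq := hsol.equation p hpU hpS
  rw [sigmaLHS] at heq
  obtain ⟨u, hu, hu1, hu2⟩ := h.exists_point (-deriv S p) (-deriv (deriv S) p)
    (neg_ne_zero.mpr hp2) (by linear_combination heq)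
  set z₀ : ℂ := p - u with hz₀
  have hpz : p - z₀ = u := by simp [hz₀]
  have hZ : AnalyticAt ℂ Z (p - z₀) := by rwa [hpz]
  set T : ℂ → ℂ := fun x => Z (x - z₀) + 0 with hT
  have hTan : AnalyticAt ℂ T p := analyticAt_translate hZ 0
  have hT1 : deriv T p = deriv S p := by
    rw [(h.deriv_translate hZ 0).self_of_nhds]
    simp only [hpz, hu1, neg_neg]
  have hT2 : deriv (deriv T) p = deriv (deriv S) p := by
    rw [h.deriv_deriv_translate hZ 0, hpz, hu2, neg_neg]
  have hS3 := deriv_three_of_sigmaLHS_eq_zero hpS (hsol.eventually_sigmaLHS_eq_zero hUo hpU hpS)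
    fun h0 => hp2 h0.self_of_nhds
  have hTeq : ∀ᶠ x in 𝓝 p, sigmaLHS 0 0 0 g₂ g₃ T x = 0 := by
    have hc : ContinuousAt (fun x => x - z₀) p := by fun_prop
    filter_upwards [hc.eventually hZ.eventually_analyticAt] with x hx
    exact h.sigmaLHS_translate hx 0
  have hT3 := deriv_three_of_sigmaLHS_eq_zero hTan hTeq
    fun h0 => hp2 (hT2 ▸ h0.self_of_nhds)
  have hdS := hpS.deriv
  have hdT := hTan.deriv
  have hd1 : deriv (fun x => deriv S x - deriv T x) =ᶠ[𝓝 p]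
      fun x => deriv (deriv S) x - deriv (deriv T) x := by
    filter_upwards [hdS.eventually_analyticAt, hdT.eventually_analyticAt] with x hx hx'
    exact deriv_fun_sub hx.differentiableAt hx'.differentiableAt
  have hdiff : ∀ᶠ x in 𝓝 p, deriv S x - deriv T x = 0 := by
    refine (hdS.sub hdT).eventually_eq_zero_of_deriv_deriv_eq_mul
      (h := fun x => -6 * (deriv S x + deriv T x)) (by fun_prop) ?_ (by simp [hT1]) ?_
    · filter_upwards [hd1.eventuallyEq_nhds, hdS.deriv.eventually_analyticAt,
        hdT.deriv.eventually_analyticAt, hS3, hT3] with x hx hxS hxT hS3 hT3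
      rw [show deriv S - deriv T = fun x => deriv S x - deriv T x from rfl, hx.deriv_eq,
        deriv_fun_sub hxS.differentiableAt hxT.differentiableAt, hS3, hT3]
      simp only [Pi.mul_apply]
      ring
    · exact hd1.self_of_nhds.trans (by simp [hT2])
  have hconst := (hpS.sub hTan).eventually_eq_of_deriv_eq_zero <| by
    filter_upwards [hdiff, hpS.eventually_analyticAt, hTan.eventually_analyticAt] with x hx hxS hxT
    rw [deriv_sub hxS.differentiableAt hxT.differentiableAt, hx]
  refine ⟨z₀, S p - T p, hsol.meromorphicOn.eventuallyEq_codiscreteWithin hUo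
    hUc.isPreconnected (fun x _ => h.meromorphicAt_translate z₀ _ x) hpU ?_⟩
  filter_upwards [hconst.filter_mono nhdsWithin_le_nhds] with x hx
  simp only [Pi.sub_apply, hT, add_zero] at hx ⊢
  linear_combination hx

theorem isSigmaSolution_and_not_isAffineOn_iff (h : IsWeierstrassPair g₂ g₃ Z P) {U : Set ℂ}
    (hUo : IsOpen U) (hUc : IsConnected U) {S : ℂ → ℂ} :
    (IsSigmaSolution 0 0 0 g₂ g₃ U S ∧ ¬ IsAffineOn U S) ↔
      ∃ z₀ B : ℂ, S =ᶠ[codiscreteWithin U] fun z => Z (z - z₀) + B :=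
  ⟨fun ⟨hsol, hna⟩ => h.exists_eq_translate hUo hUc hsol hna, fun ⟨_, _, hST⟩ =>
    ⟨h.isSigmaSolution hUo hST, h.not_isAffineOn hUo hUc.nonempty hST⟩⟩

end IsWeierstrassPair

/-! ### The Weierstrass zeta function of a lattice -/

namespace PeriodPair

variable (L : PeriodPair)

theorem norm_weierstrassZeta_term_le {r : ℝ} {s l : ℂ} (hr : 0 < r) (hs : ‖s‖ < r)
    (h : 2 * r ≤ ‖l‖) :
    ‖1 / (s - l) + 1 / l + s / l ^ 2‖ ≤ 2 * r ^ 2 * ‖l‖ ^ (-3 : ℝ) := by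
  have hl : 0 < ‖l‖ := by linarith
  have hl0 : l ≠ 0 := norm_pos_iff.mp hl
  have hlow : ‖l‖ / 2 ≤ ‖s - l‖ := by
    have := norm_sub_norm_le l s
    rw [norm_sub_rev] at this
    linarith
  have hsl : s - l ≠ 0 := norm_pos_iff.mp (by linarith)
  calc ‖1 / (s - l) + 1 / l + s / l ^ 2‖ = ‖s ^ 2 / ((s - l) * l ^ 2)‖ := by
        congr 1; field_simp; ring
    _ = ‖s‖ ^ 2 / (‖s - l‖ * ‖l‖ ^ 2) := by simp
    _ ≤ r ^ 2 / (‖l‖ / 2 * ‖l‖ ^ 2) := by gcongr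
    _ = 2 * r ^ 2 / ‖l‖ ^ 3 := by field_simp
    _ = _ := by norm_cast

/-- The Weierstrass zeta function with the `l₀`-term missing. -/
noncomputable def weierstrassZetaExcept (l₀ z : ℂ) : ℂ :=
  ∑' l : L.lattice, if (l : ℂ) = l₀ then 0 else (1 / (z - l) + 1 / (l : ℂ) + z / (l : ℂ) ^ 2)

theorem hasSumLocallyUniformly_weierstrassZetaExcept (l₀ : ℂ) :
    HasSumLocallyUniformly
      (fun (l : L.lattice) (z : ℂ) ↦
        if (l : ℂ) = l₀ then 0 else (1 / (z - l) + 1 / (l : ℂ) + z / (l : ℂ) ^ 2))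
      (L.weierstrassZetaExcept l₀) := by
  refine L.hasSumLocallyUniformly_aux (u := (2 * · ^ 2 * ‖·‖ ^ (-3 : ℝ))) _
    (fun _ _ ↦ (ZLattice.summable_norm_rpow _ _ (by simp; norm_num)).mul_left _) fun r hr ↦
    Filter.eventually_atTop.mpr ⟨2 * r, ?_⟩
  rintro _ h s hs l rfl
  split_ifs
  · simpa using! show 0 ≤ 2 * r ^ 2 * (‖↑l‖ ^ 3)⁻¹ by positivity
  · exact norm_weierstrassZeta_term_le hr hs h

theorem sub_coe_ne_zero_of_mem_compl {l₀ z : ℂ} (hz : z ∈ (L.lattice \ {l₀} : Set ℂ)ᶜ)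
    (l : L.lattice) (hl : (l : ℂ) ≠ l₀) : z - l ≠ 0 := by
  intro e
  obtain rfl := sub_eq_zero.mp e
  exact hz ⟨l.2, hl⟩

theorem differentiableOn_weierstrassZetaExcept (l₀ : ℂ) :
    DifferentiableOn ℂ (L.weierstrassZetaExcept l₀) (L.lattice \ {l₀})ᶜ := by
  refine (L.hasSumLocallyUniformly_weierstrassZetaExcept l₀).tendstoLocallyUniformlyOn
    |>.differentiableOn (.of_forall fun s ↦ .fun_sum fun i hi ↦ ?_) L.isOpen_compl_lattice_sdiff
  split_ifs with h
  · simp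
  · intro x hx
    have := L.sub_coe_ne_zero_of_mem_compl hx i h
    fun_prop (disch := assumption)

theorem eqOn_deriv_weierstrassZetaExcept (l₀ : ℂ) :
    Set.EqOn (deriv (L.weierstrassZetaExcept l₀)) (fun z => -L.weierstrassPExcept l₀ z)
      (L.lattice \ {l₀})ᶜ := by
  have hdiff : ∀ z ∈ (L.lattice \ {l₀} : Set ℂ)ᶜ, ∀ l : L.lattice,
      HasDerivAt (fun z : ℂ ↦
        if (l : ℂ) = l₀ then 0 else (1 / (z - l) + 1 / (l : ℂ) + z / (l : ℂ) ^ 2))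
        (-(if (l : ℂ) = l₀ then 0 else (1 / (z - l) ^ 2 - 1 / (l : ℂ) ^ 2))) z := by
    intro z hz l
    split_ifs with h
    · simpa using hasDerivAt_const z (0 : ℂ)
    · have hne := L.sub_coe_ne_zero_of_mem_compl hz l h
      have h1 := ((hasDerivAt_id z).sub_const (l : ℂ)).inv hne
      have h2 := (h1.add_const (1 / (l : ℂ))).add ((hasDerivAt_id z).div_const ((l : ℂ) ^ 2))
      refine (h2.congr_deriv ?_).congr_of_eventuallyEq (.of_forall fun y => ?_)
      · simp [id]; ring
      · simp
  refine ((L.hasSumLocallyUniformly_weierstrassZetaExcept l₀).tendstoLocallyUniformlyOn.deriv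
    (.of_forall fun s z hz ↦ ?_) L.isOpen_compl_lattice_sdiff).unique ?_
  · exact (DifferentiableAt.fun_sum fun i _ =>
      (hdiff z hz i).differentiableAt).differentiableWithinAt
  · have := (L.hasSumLocallyUniformly_weierstrassPExcept l₀).tendstoLocallyUniformlyOn
      (s := (L.lattice \ {l₀} : Set ℂ)ᶜ)
    refine this.neg.congr fun s z hz => ?_
    simp only [Function.comp_apply, Pi.neg_apply]
    rw [deriv_fun_sum fun i _ => (hdiff z hz i).differentiableAt, ← Finset.sum_neg_distrib]
    exact Finset.sum_congr rfl fun i _ => (hdiff z hz i).deriv.symm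

theorem weierstrassZetaExcept_add (l₀ : L.lattice) (z : ℂ) :
    L.weierstrassZetaExcept l₀ z + (1 / (z - l₀) + 1 / (l₀ : ℂ) + z / (l₀ : ℂ) ^ 2) =
      L.weierstrassZeta z := by
  have h1 := (L.hasSumLocallyUniformly_weierstrassZetaExcept l₀).hasSum (x := z)
  have h2 : HasSum (fun l : L.lattice ↦ if l = l₀ then
      (1 / (z - l₀) + 1 / (l₀ : ℂ) + z / (l₀ : ℂ) ^ 2) else 0) _ := hasSum_ite_eq l₀ _
  rw [weierstrassZeta, ← (h1.add h2).tsum_eq]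
  refine tsum_congr fun l => ?_
  by_cases h : l = l₀
  · simp [h]
  · simp [h, Subtype.coe_injective.eq_iff]

theorem weierstrassZetaExcept_of_notMem {l₀ : ℂ} (hl : l₀ ∉ L.lattice) :
    L.weierstrassZetaExcept l₀ = L.weierstrassZeta := by
  ext z
  refine tsum_congr fun l => if_neg ?_
  rintro rfl
  exact hl l.2

theorem analyticAt_weierstrassZeta {z : ℂ} (hz : z ∉ L.lattice) :
    AnalyticAt ℂ L.weierstrassZeta z := by
  rw [← L.weierstrassZetaExcept_of_notMem L.ω₁_div_two_notMem_lattice]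
  exact (L.differentiableOn_weierstrassZetaExcept _).analyticOnNhd L.isOpen_compl_lattice_sdiff z
    fun h => hz h.1

theorem deriv_weierstrassZeta {z : ℂ} (hz : z ∉ L.lattice) :
    deriv L.weierstrassZeta z = -L.weierstrassP z := by
  rw [← L.weierstrassZetaExcept_of_notMem L.ω₁_div_two_notMem_lattice,
    L.eqOn_deriv_weierstrassZetaExcept _ fun h => hz h.1,
    L.weierstrassPExcept_of_notMem _ L.ω₁_div_two_notMem_lattice]

theorem meromorphicOrderAt_weierstrassZeta {l : ℂ} (hl : l ∈ L.lattice) :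
    meromorphicOrderAt L.weierstrassZeta l = -1 := by
  have hE : AnalyticAt ℂ (L.weierstrassZetaExcept l) l :=
    (L.differentiableOn_weierstrassZetaExcept l).analyticOnNhd L.isOpen_compl_lattice_sdiff l
      (by simp)
  have hinv : meromorphicOrderAt (fun z => (z - l)⁻¹) l = -1 := by
    change meromorphicOrderAt (fun z => z - l)⁻¹ l = -1
    rw [meromorphicOrderAt_inv]
    simp
  have hA : AnalyticAt ℂ (fun z => L.weierstrassZetaExcept l z + (1 / l + z / l ^ 2)) l := by
    simp only [div_eq_mul_inv]
    fun_prop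
  have hsum : L.weierstrassZeta =
      (fun z => (z - l)⁻¹) + fun z => L.weierstrassZetaExcept l z + (1 / l + z / l ^ 2) := by
    ext z
    rw [← L.weierstrassZetaExcept_add ⟨l, hl⟩ z]
    simp only [Pi.add_apply, one_div]
    ring
  rw [hsum, meromorphicOrderAt_add_eq_left_of_lt hA.meromorphicAt, hinv]
  rw [hinv]
  exact lt_of_lt_of_le (by decide) hA.meromorphicOrderAt_nonneg

theorem analyticAt_weierstrassZeta_iff {z : ℂ} :
    AnalyticAt ℂ L.weierstrassZeta z ↔ z ∉ L.lattice := by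
  refine ⟨fun h hz => ?_, L.analyticAt_weierstrassZeta⟩
  have := h.meromorphicOrderAt_nonneg
  rw [L.meromorphicOrderAt_weierstrassZeta hz] at this
  exact absurd this (by decide)

/-! ### Surjectivity of the Weierstrass `℘` function -/

/-- If `℘` omitted the value `c`, then `1 / (℘ - c)`, set to `0` on the lattice, would be a bounded
entire function with zeros, hence identically zero. -/
theorem exists_weierstrassP_eq (c : ℂ) : ∃ u, u ∉ L.lattice ∧ L.weierstrassP u = c := by
  classical
  by_contra! hc
  set f : ℂ → ℂ := fun z => if z ∈ L.lattice then 0 else (L.weierstrassP z - c)⁻¹ with hf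
  have hdiff : Differentiable ℂ f := by
    intro x
    refine AnalyticAt.differentiableAt ?_
    by_cases hx : x ∈ L.lattice
    · have hcongr : f =ᶠ[𝓝[≠] x] (L.weierstrassP + fun _ => -c)⁻¹ := by
        filter_upwards [self_mem_nhdsWithin, mem_nhdsWithin_of_mem_nhds
          (L.compl_lattice_sdiff_singleton_mem_nhds x)] with w hw hw'
        have : w ∉ L.lattice := fun h => hw' ⟨h, hw⟩
        simp [hf, this, sub_eq_add_neg]
      refine .of_meromorphicOrderAt_pos ?_ (by simp [hf, hx])
      rw [meromorphicOrderAt_congr hcongr, meromorphicOrderAt_inv,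
        meromorphicOrderAt_add_eq_left_of_lt (MeromorphicAt.const _ _), L.order_weierstrassP x hx]
      · decide
      · rw [L.order_weierstrassP x hx]
        exact lt_of_lt_of_le (by decide)
          (analyticAt_const (𝕜 := ℂ) (v := -c)).meromorphicOrderAt_nonneg
    · have h1 := L.analyticOnNhd_weierstrassP x hx
      have h2 : AnalyticAt ℂ (fun z => (L.weierstrassP z - c)⁻¹) x :=
        (h1.sub analyticAt_const).inv (sub_ne_zero.mpr (hc x hx))
      refine h2.congr ?_
      filter_upwards [L.isClosed_lattice.isOpen_compl.mem_nhds hx] with z hz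
      have hz' : z ∉ L.lattice := hz
      simp [hf, hz']
  have hper : ∀ z, ∀ w ∈ L.lattice, f (z + w) = f z := by
    intro z w hw
    have h1 : z + w ∈ L.lattice ↔ z ∈ L.lattice := L.lattice.add_mem_iff_left hw
    have h2 : L.weierstrassP (z + w) = L.weierstrassP z := L.weierstrassP_add_coe z ⟨w, hw⟩
    simp only [hf, h1, h2]
  have h0 := hdiff.apply_eq_apply_of_bounded
    (IsZLattice.isCompact_range_of_periodic L.lattice _ hdiff.continuous hper).isBounded
    (L.ω₁ / 2) 0
  have hw := L.ω₁_div_two_notMem_lattice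
  simp only [hf, hw, if_false, L.lattice.zero_mem, if_true, inv_eq_zero] at h0
  exact hc _ hw (sub_eq_zero.mp h0)

theorem exists_weierstrassP_eq_and_derivWeierstrassP_eq {c d : ℂ}
    (h : d ^ 2 = 4 * c ^ 3 - L.g₂ * c - L.g₃) :
    ∃ u, u ∉ L.lattice ∧ L.weierstrassP u = c ∧ L.derivWeierstrassP u = d := by
  obtain ⟨u, hu, rfl⟩ := L.exists_weierstrassP_eq c
  rw [← L.derivWeierstrassP_sq u hu] at h
  rcases sq_eq_sq_iff_eq_or_eq_neg.mp h with h | h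
  · exact ⟨u, hu, rfl, h.symm⟩
  · exact ⟨-u, by simpa using hu, by simp, by simp [h]⟩

theorem isWeierstrassPair : IsWeierstrassPair L.g₂ L.g₃ L.weierstrassZeta L.weierstrassP where
  analyticAt_or_pole u := by
    by_cases hu : u ∈ L.lattice
    · right
      rw [L.meromorphicOrderAt_weierstrassZeta hu]
      decide
    · exact Or.inl (L.analyticAt_weierstrassZeta hu)
  pole_zero := by
    rw [L.meromorphicOrderAt_weierstrassZeta L.lattice.zero_mem]
    decide
  deriv_eq u hu := L.deriv_weierstrassZeta (L.analyticAt_weierstrassZeta_iff.mp hu)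
  equation u hu := by
    rw [L.deriv_weierstrassP]
    exact L.derivWeierstrassP_sq u (L.analyticAt_weierstrassZeta_iff.mp hu)
  exists_point c d _ h := by
    obtain ⟨u, hu, hc, hd⟩ := L.exists_weierstrassP_eq_and_derivWeierstrassP_eq h
    exact ⟨u, L.analyticAt_weierstrassZeta hu, hc, by rw [L.deriv_weierstrassP, hd]⟩

theorem isElliptic_neg_weierstrassP_translate (z₀ : ℂ) :
    IsElliptic fun z => -L.weierstrassP (z - z₀) := by
  refine ⟨fun z _ => ?_, L, fun l hl z => ?_⟩
  · exact ((L.meromorphic_weierstrassP (z - z₀)).comp_analyticAt (g := fun z => z - z₀)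
      (by fun_prop)).neg
  · have := L.weierstrassP_add_coe (z - z₀) ⟨l, hl⟩
    simp only [← this]
    congr 2
    ring

end PeriodPair

/-! ### The degenerate case -/

theorem exists_invariants_eq_of_discriminant_eq_zero {g₂ g₃ : ℂ}
    (h : g₂ ^ 3 - 27 * g₃ ^ 2 = 0) :
    ∃ k : ℂ, g₂ = 4 / 3 * k ^ 4 ∧ g₃ = -(8 / 27) * k ^ 6 := by
  by_cases h2 : g₂ = 0
  · have h3 : g₃ = 0 := by simpa [h2] using h
    exact ⟨0, by simp [h2], by simp [h3]⟩
  · -- both relations hold when `k² = -9 g₃ / (2 g₂)`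
    obtain ⟨k, hk⟩ := IsSquare.exists_sq _ (Complex.isSquare (-(9 / 2) * g₃ / g₂))
    refine ⟨k, ?_, ?_⟩
    · rw [show k ^ 4 = (k ^ 2) ^ 2 by ring, ← hk]
      field_simp
      linear_combination 12 * h
    · rw [show k ^ 6 = (k ^ 2) ^ 3 by ring, ← hk]
      field_simp
      linear_combination 216 * g₃ * h

theorem isWeierstrassPair_degenerate_zero :
    IsWeierstrassPair 0 0 (degenerateZeta 0) (degenerateP 0) := by
  have hZ : degenerateZeta 0 = fun z => z⁻¹ := by
    ext z; simp [degenerateZeta]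
  have hP : degenerateP 0 = fun z => (z ^ 2)⁻¹ := by
    ext z; simp [degenerateP]
  have hpole : meromorphicOrderAt (fun z : ℂ => z⁻¹) 0 < 0 := by
    change meromorphicOrderAt (id : ℂ → ℂ)⁻¹ 0 < 0
    rw [meromorphicOrderAt_inv, meromorphicOrderAt_id]
    decide
  have hne {u : ℂ} (hu : AnalyticAt ℂ (fun z : ℂ => z⁻¹) u) : u ≠ 0 := by
    rintro rfl
    exact hpole.not_ge hu.meromorphicOrderAt_nonneg
  have hdP {u : ℂ} (hu : u ≠ 0) : deriv (fun z : ℂ => (z ^ 2)⁻¹) u = -2 / u ^ 3 := by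
    have := ((hasDerivAt_pow 2 u).fun_inv (pow_ne_zero 2 hu)).deriv
    rw [this]
    field_simp
    norm_num [mul_comm]
  rw [hZ, hP]
  refine ⟨fun u => ?_, hpole, fun u _ => by simp, fun u hu => ?_, fun c d hd h => ?_⟩
  · by_cases hu : u = 0
    · exact Or.inr (hu ▸ hpole)
    · exact Or.inl (analyticAt_inv hu)
  · have := hne hu
    rw [hdP this]
    field_simp
    ring
  · -- the rational parametrisation `u = -2 c / d` of the cuspidal cubic `d² = 4 c³`
    have hc : c ≠ 0 := by
      rintro rfl
      exact hd (by simpa using h)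
    have hu : -2 * c / d ≠ 0 := by simp [hc, hd]
    refine ⟨-2 * c / d, analyticAt_inv hu, ?_, ?_⟩
    · field_simp
      linear_combination h
    · rw [hdP hu]
      field_simp
      linear_combination h

theorem isWeierstrassPair_degenerate {k : ℂ} (hk : k ≠ 0) :
    IsWeierstrassPair (4 / 3 * k ^ 4) (-(8 / 27) * k ^ 6) (degenerateZeta k) (degenerateP k) := by
  have hZ : degenerateZeta k = fun z =>
      k * Complex.cosh (k * z) / Complex.sinh (k * z) - k ^ 2 * z / 3 := by
    ext z; simp [degenerateZeta, hk]
  have hP : degenerateP k = fun z => k ^ 2 / 3 + k ^ 2 / Complex.sinh (k * z) ^ 2 := by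
    ext z; simp [degenerateP, hk]
  have hs (u : ℂ) : HasDerivAt (fun z => Complex.sinh (k * z)) (Complex.cosh (k * u) * k) u := by
    simpa using ((hasDerivAt_id u).const_mul k).csinh
  have hc (u : ℂ) : HasDerivAt (fun z => Complex.cosh (k * z)) (Complex.sinh (k * u) * k) u := by
    simpa using ((hasDerivAt_id u).const_mul k).ccosh
  have hsA (u : ℂ) : AnalyticAt ℂ (fun z => Complex.sinh (k * z)) u :=
    Complex.analyticAt_sinh.fun_comp (by fun_prop)
  have hcA (u : ℂ) : AnalyticAt ℂ (fun z => Complex.cosh (k * z)) u :=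
    Complex.analyticAt_cosh.fun_comp (by fun_prop)
  have hcs (u : ℂ) := Complex.cosh_sq_sub_sinh_sq (k * u)
  have hZA {u : ℂ} (hu : Complex.sinh (k * u) ≠ 0) : AnalyticAt ℂ (degenerateZeta k) u := by
    rw [hZ]
    exact ((analyticAt_const.mul (hcA u)).div (hsA u) hu).sub (by fun_prop)
  have hpole {u : ℂ} (hu : Complex.sinh (k * u) = 0) :
      meromorphicOrderAt (degenerateZeta k) u < 0 := by
    have hcu : Complex.cosh (k * u) ≠ 0 := by
      intro h0
      have := hcs u
      rw [h0, hu] at this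
      norm_num at this
    have ho : analyticOrderAt (fun z => Complex.sinh (k * z)) u = 1 :=
      (hsA u).analyticOrderAt_eq_one_of_zero_deriv_ne_zero hu
        (by rw [(hs u).deriv]; exact mul_ne_zero hcu hk)
    have hq : meromorphicOrderAt
        ((fun z => k * Complex.cosh (k * z)) * (fun z => Complex.sinh (k * z))⁻¹) u = -1 := by
      rw [meromorphicOrderAt_mul_of_ne_zero
          (show AnalyticAt ℂ (fun z => k * Complex.cosh (k * z)) u from analyticAt_const.mul (hcA u))
          (mul_ne_zero hk hcu),
        meromorphicOrderAt_inv, (hsA u).meromorphicOrderAt_eq, ho]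
      rfl
    have hsum : degenerateZeta k =
        ((fun z => k * Complex.cosh (k * z)) * (fun z => Complex.sinh (k * z))⁻¹) +
          fun z => -(k ^ 2 * z / 3) := by
      rw [hZ]; ext z; simp [div_eq_mul_inv, sub_eq_add_neg]
    have hA : AnalyticAt ℂ (fun z => -(k ^ 2 * z / 3)) u := by fun_prop
    have hlt := lt_of_lt_of_le (show (-1 : WithTop ℤ) < 0 by decide) hA.meromorphicOrderAt_nonneg
    rw [hsum, meromorphicOrderAt_add_eq_left_of_lt hA.meromorphicAt (by rwa [hq]), hq]
    decide
  have hne {u : ℂ} (hu : AnalyticAt ℂ (degenerateZeta k) u) : Complex.sinh (k * u) ≠ 0 := fun h =>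
    (hpole h).not_ge hu.meromorphicOrderAt_nonneg
  have hdP {u : ℂ} (hu : Complex.sinh (k * u) ≠ 0) : deriv (degenerateP k) u =
      -2 * k ^ 3 * Complex.cosh (k * u) / Complex.sinh (k * u) ^ 3 := by
    have := (((((hs u).fun_pow 2).fun_inv (pow_ne_zero 2 hu)).const_mul (k ^ 2)).const_add
      (k ^ 2 / 3)).deriv
    rw [hP]
    simp only [div_eq_mul_inv] at this ⊢
    rw [this]
    field_simp
    ring
  have hE {u : ℂ} (hu : Complex.sinh (k * u) ≠ 0) : deriv (degenerateP k) u ^ 2 =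
      4 * degenerateP k u ^ 3 - 4 / 3 * k ^ 4 * degenerateP k u - -(8 / 27) * k ^ 6 := by
    rw [hdP hu, hP]
    field_simp
    linear_combination 2916 * hcs u
  refine ⟨fun u => ?_, hpole (by simp), fun u hu => ?_, fun u hu => hE (hne hu),
    fun c d hd h => ?_⟩
  · by_cases hu : Complex.sinh (k * u) = 0
    · exact Or.inr (hpole hu)
    · exact Or.inl (hZA hu)
  · have hu' := hne hu
    have := ((((hc u).const_mul k).fun_div (hs u) hu').sub
      (((hasDerivAt_id u).const_mul (k ^ 2)).div_const 3)).deriv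
    rw [hZ, hP]
    refine this.trans ?_
    field_simp
    linear_combination (-3) * hcs u
  · -- `k² / 3` is a double root of the cubic, so it is excluded by `d ≠ 0`; every other value
    -- `c` is attained since `sinh²` is surjective
    have hc3 : c - k ^ 2 / 3 ≠ 0 := by
      intro h0
      obtain rfl : c = k ^ 2 / 3 := by linear_combination h0
      exact hd (pow_eq_zero_iff two_ne_zero |>.mp (by rw [h]; ring))
    obtain ⟨s, hs2⟩ := IsSquare.exists_sq _ (Complex.isSquare (k ^ 2 / (c - k ^ 2 / 3)))
    obtain ⟨v, hv⟩ := Complex.sin_surjective (s * Complex.I)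
    set u : ℂ := -v * Complex.I / k with hu
    have hsu : Complex.sinh (k * u) = s := by
      rw [hu, mul_div_cancel₀ _ hk, Complex.sinh_mul_I, Complex.sin_neg, hv]
      linear_combination (-s) * Complex.I_sq
    have hs0 : s ≠ 0 := by
      rintro rfl
      have : k ^ 2 / (c - k ^ 2 / 3) ≠ 0 := div_ne_zero (pow_ne_zero 2 hk) hc3
      exact this (by rw [hs2]; ring)
    have hPu : degenerateP k u = c := by
      rw [hP]
      simp only [hsu, ← hs2]
      field_simp
      ring
    have hu0 : Complex.sinh (k * u) ≠ 0 := hsu ▸ hs0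
    have hsq : d ^ 2 = deriv (degenerateP k) u ^ 2 := by rw [hE hu0, hPu, h]
    rcases sq_eq_sq_iff_eq_or_eq_neg.mp hsq with h' | h'
    · exact ⟨u, hZA hu0, hPu, h'.symm⟩
    · -- the derivative is odd and the function is even
      have hun : Complex.sinh (k * -u) ≠ 0 := by simpa using hu0
      refine ⟨-u, hZA hun, ?_, ?_⟩
      · rw [← hPu, hP]; simp
      · rw [h', hdP hun, hdP hu0]
        simp only [mul_neg, Complex.sinh_neg, Complex.cosh_neg, Odd.neg_pow (by decide : Odd 3)]
        field_simp

theorem isWeierstrassPair_degenerateZeta (k : ℂ) :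
    IsWeierstrassPair (4 / 3 * k ^ 4) (-(8 / 27) * k ^ 6) (degenerateZeta k) (degenerateP k) := by
  rcases eq_or_ne k 0 with rfl | hk
  · simpa using isWeierstrassPair_degenerate_zero
  · exact isWeierstrassPair_degenerate hk

/-! ### Existence of a lattice with given invariants -/

section Uniformization

open UpperHalfPlane ModularForm ModularFormClass EisensteinSeries SlashInvariantForm
open scoped MatrixGroups Manifold

theorem ModularForm.tendsto_valueAtInfty {k : ℤ} (f : ModularForm 𝒮ℒ k) :
    Tendsto f atImInfty (𝓝 (valueAtInfty f)) := by
  obtain ⟨c, hc, hO⟩ := exp_decay_sub_atImInfty' f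
  have hexp : Tendsto (fun τ : ℍ => Real.exp (-c * τ.im)) atImInfty (𝓝 0) := by
    refine Real.tendsto_exp_atBot.comp ?_
    have him : Tendsto (fun τ : ℍ => τ.im) atImInfty atTop := tendsto_comap
    exact him.const_mul_atTop_of_neg (neg_lt_zero.mpr hc)
  simpa using (hO.trans_tendsto hexp).add_const (valueAtInfty f)

theorem ModularForm.tendsto_E_atImInfty {k : ℕ} (hk : 3 ≤ k) (hk2 : Even k) :
    Tendsto (E hk) atImInfty (𝓝 1) := by
  have h := tendsto_valueAtInfty (E hk)
  rwa [← qExpansion_coeff_zero one_pos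
    (ModularFormClass.analyticAt_cuspFunction_zero (E hk) one_pos one_mem_strictPeriods_SL)
    (SlashInvariantFormClass.periodic_comp_ofComplex (E hk) one_mem_strictPeriods_SL),
    E_qExpansion_coeff_zero hk hk2] at h

/-- A level one modular form of positive weight that does not vanish at the cusp vanishes somewhere
in the upper half plane: otherwise its inverse would be a nonzero modular form of negative
weight. -/
theorem ModularForm.exists_apply_eq_zero_of_levelOne {k : ℤ} (hk : 0 < k) (f : ModularForm 𝒮ℒ k)
    {c : ℂ} (hc : c ≠ 0) (hf : Tendsto f atImInfty (𝓝 c)) : ∃ τ, f τ = 0 := by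
  by_contra! hne
  have hslash (γ : SL(2, ℤ)) : (fun z => 1 / f z) ∣[-k] γ = fun z => 1 / f z := by
    have hγ : (γ : GL (Fin 2) ℝ) ∈ 𝒮ℒ := ⟨γ, rfl⟩
    have h := div_slash_SL2 0 k γ (1 : ℍ → ℂ) f
    rw [is_invariant_one, zero_sub] at h
    refine h.trans ?_
    rw [SL_slash, SlashInvariantForm.slash_action_eqn f _ hγ]
    rfl
  let g : ModularForm 𝒮ℒ (-k) :=
    { toFun := fun z => 1 / f z
      slash_action_eq' := fun _ ⟨γ, hγ⟩ => hγ ▸ hslash γ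
      holo' := mdifferentiable_const.div f.holo' hne
      bdd_at_cusps' := fun {c'} hc' => by
        rw [Subgroup.IsArithmetic.isCusp_iff_isCusp_SL2Z] at hc'
        rw [OnePoint.isBoundedAt_iff_forall_SL2Z hc']
        intro γ _
        rw [hslash γ, IsBoundedAtImInfty, BoundedAtFilter]
        exact (tendsto_const_nhds.div hf hc).isBigO_one ℝ }
  have hg : ⇑g = 0 := levelOne_neg_weight_eq_zero (neg_lt_zero.mpr hk) g
  have hI : 1 / f I = 0 := congrFun hg I
  exact hne I (by simpa using hI)

theorem ModularForm.E₄_cube_ne_E₆_sq (τ : ℍ) : E₄ τ ^ 3 - E₆ τ ^ 2 ≠ 0 := by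
  intro h
  have := discriminant_eq_E₄_cube_sub_E₆_sq τ
  rw [h, zero_div] at this
  exact discriminant_ne_zero τ this

/-- The map `τ ↦ (E₄(τ)³ : E₆(τ)²)` from the upper half plane hits every point of the projective
line except the value `(1 : 1)` at the cusp. -/
theorem ModularForm.exists_E₄_E₆_eq {a b : ℂ} (hab : a ≠ b) :
    ∃ τ : ℍ, b * E₄ τ ^ 3 = a * E₆ τ ^ 2 := by
  let f : ModularForm 𝒮ℒ 12 := b • ModularForm.mcast (by decide) (E₄.pow 3) -
    a • ModularForm.mcast (by decide) (E₆.pow 2)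
  have hf : ⇑f = fun τ => b * E₄ τ ^ 3 - a * E₆ τ ^ 2 := by
    ext τ
    simp only [f, ModularForm.coe_mcast, ModularForm.coe_pow, FunLike.coe_sub, FunLike.coe_smul,
      Pi.sub_apply, Pi.smul_apply, Pi.pow_apply, smul_eq_mul]
  have h4 := tendsto_E_atImInfty (by norm_num : 3 ≤ 4) ⟨2, rfl⟩
  have h6 := tendsto_E_atImInfty (by norm_num : 3 ≤ 6) ⟨3, rfl⟩
  have hlim : Tendsto f atImInfty (𝓝 (b * 1 ^ 3 - a * 1 ^ 2)) := by
    rw [hf]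
    exact ((h4.pow 3).const_mul b).sub ((h6.pow 2).const_mul a)
  obtain ⟨τ, hτ⟩ := exists_apply_eq_zero_of_levelOne (by norm_num) f
    (by simpa [sub_eq_zero] using hab.symm) hlim
  rw [hf] at hτ
  exact ⟨τ, sub_eq_zero.mp hτ⟩

theorem riemannZeta_six : riemannZeta 6 = (Real.pi : ℂ) ^ 6 / 945 := by
  have h := riemannZeta_two_mul_nat (k := 3) (by norm_num)
  rw [show bernoulli (2 * 3) = 1 / 42 by decide +kernel] at h
  norm_num [Nat.factorial] at h
  rw [h]
  ring

namespace PeriodPair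

/-- The period pair `(μ τ, μ)`. -/
def ofUpperHalfPlane (μ : ℂ) (hμ : μ ≠ 0) (τ : ℍ) : PeriodPair where
  ω₁ := μ * τ
  ω₂ := μ
  indep := by
    rw [LinearIndependent.pair_iff]
    intro s t h
    have h1 : (s : ℂ) * τ + t = 0 := by
      apply mul_left_cancel₀ hμ
      simp only [Complex.real_smul] at h
      linear_combination h
    have hs : s = 0 := by
      have := congrArg Complex.im h1
      simpa [τ.im_ne_zero] using this
    refine ⟨hs, ?_⟩
    simpa [hs] using h1

theorem G_ofUpperHalfPlane {μ : ℂ} (hμ : μ ≠ 0) (τ : ℍ) {k : ℕ} (hk : 3 ≤ k) :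
    (ofUpperHalfPlane μ hμ τ).G k = (μ ^ k)⁻¹ * (2 * riemannZeta k * E hk τ) := by
  set L := ofUpperHalfPlane μ hμ τ with hL
  have hE : E hk τ = 1 / 2 * eisensteinSeries (N := 1) 0 k τ := rfl
  have h2 : 2 * riemannZeta k * E hk τ = ∑' v : Fin 2 → ℤ, eisSummand k v τ := by
    rw [tsum_eisSummand_eq_riemannZeta_mul_eisensteinSeries hk, hE]
    ring
  rw [h2, ← tsum_mul_left, G,
    ← ((finTwoArrowEquiv ℤ).trans L.latticeEquivProd.symm.toEquiv).tsum_eq]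
  refine tsum_congr fun v => ?_
  have hv : ((((finTwoArrowEquiv ℤ).trans L.latticeEquivProd.symm.toEquiv) v : L.lattice) : ℂ) =
      μ * (v 0 * τ + v 1) := by
    change ((L.latticeEquivProd.symm (v 0, v 1) : L.lattice) : ℂ) = _
    rw [L.latticeEquiv_symm_apply]
    simp only [hL, ofUpperHalfPlane]
    ring
  rw [hv, mul_pow, mul_inv, eisSummand, zpow_neg, zpow_natCast]

theorem g₂_ofUpperHalfPlane {μ : ℂ} (hμ : μ ≠ 0) (τ : ℍ) :
    (ofUpperHalfPlane μ hμ τ).g₂ = (μ ^ 4)⁻¹ * (4 / 3 * (Real.pi : ℂ) ^ 4 * E₄ τ) := by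
  have := G_ofUpperHalfPlane hμ τ (by norm_num : 3 ≤ 4)
  push_cast at this
  rw [g₂, this, riemannZeta_four]
  ring

theorem g₃_ofUpperHalfPlane {μ : ℂ} (hμ : μ ≠ 0) (τ : ℍ) :
    (ofUpperHalfPlane μ hμ τ).g₃ = (μ ^ 6)⁻¹ * (8 / 27 * (Real.pi : ℂ) ^ 6 * E₆ τ) := by
  have := G_ofUpperHalfPlane hμ τ (by norm_num : 3 ≤ 6)
  push_cast at this
  rw [g₃, this, riemannZeta_six]
  ring

/-- Every pair of invariants with nonzero discriminant is that of a lattice: the modular forms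
`E₄`, `E₆` provide a lattice with proportional `(g₂³ : g₃²)`, which is then rescaled. -/
theorem exists_g₂_eq_g₃_eq {g₂ g₃ : ℂ} (h : g₂ ^ 3 - 27 * g₃ ^ 2 ≠ 0) :
    ∃ L : PeriodPair, L.g₂ = g₂ ∧ L.g₃ = g₃ := by
  obtain ⟨τ, hτ⟩ := exists_E₄_E₆_eq (sub_ne_zero.mp h)
  have hne := E₄_cube_ne_E₆_sq τ
  set A : ℂ := 4 / 3 * (Real.pi : ℂ) ^ 4 * E₄ τ with hA
  set B : ℂ := 8 / 27 * (Real.pi : ℂ) ^ 6 * E₆ τ with hB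
  have hπ : (Real.pi : ℂ) ≠ 0 := by exact_mod_cast Real.pi_ne_zero
  have hAB : g₃ ^ 2 * A ^ 3 = g₂ ^ 3 * B ^ 2 := by
    rw [hA, hB]
    linear_combination (64 / 729 * (Real.pi : ℂ) ^ 12) * hτ
  have hABne : A ^ 3 - 27 * B ^ 2 ≠ 0 := by
    have : A ^ 3 - 27 * B ^ 2 = 64 / 27 * (Real.pi : ℂ) ^ 12 * (E₄ τ ^ 3 - E₆ τ ^ 2) := by
      rw [hA, hB]; ring
    rw [this]
    exact mul_ne_zero (mul_ne_zero (by norm_num) (pow_ne_zero _ hπ)) hne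
  obtain ⟨μ, hμ, h4, h6⟩ : ∃ μ : ℂ, μ ≠ 0 ∧ g₂ * μ ^ 4 = A ∧ g₃ * μ ^ 6 = B := by
    clear_value A B
    by_cases h2 : g₂ = 0
    · have h3 : g₃ ≠ 0 := by rintro rfl; simp [h2] at h
      have hA0 : A = 0 := by simpa [h2, h3] using hAB
      have hB0 : B ≠ 0 := by rintro rfl; simp [hA0] at hABne
      obtain ⟨μ, hμ⟩ := IsAlgClosed.exists_pow_nat_eq (B / g₃) (n := 6) (by norm_num)
      refine ⟨μ, ?_, by rw [h2, hA0, zero_mul], by rw [hμ]; field_simp⟩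
      rintro rfl
      exact div_ne_zero hB0 h3 (by rw [← hμ]; norm_num)
    · by_cases h3 : g₃ = 0
      · have hB0 : B = 0 := by simpa [h2, h3] using hAB
        have hA0 : A ≠ 0 := by rintro rfl; simp [hB0] at hABne
        obtain ⟨μ, hμ⟩ := IsAlgClosed.exists_pow_nat_eq (A / g₂) (n := 4) (by norm_num)
        refine ⟨μ, ?_, by rw [hμ]; field_simp, by rw [h3, hB0, zero_mul]⟩
        rintro rfl
        exact div_ne_zero hA0 h2 (by rw [← hμ]; norm_num)
      · have hA0 : A ≠ 0 := by
          rintro rfl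
          have : B = 0 := by simpa [h2] using hAB.symm
          simp [this] at hABne
        have hB0 : B ≠ 0 := by
          rintro rfl
          simp [h3, hA0] at hAB
        -- dividing the two required relations gives `μ² = B g₂ / (A g₃)`
        obtain ⟨μ, hμ⟩ := IsAlgClosed.exists_pow_nat_eq (B * g₂ / (A * g₃)) (n := 2) (by norm_num)
        refine ⟨μ, ?_, ?_, ?_⟩
        · rintro rfl
          exact div_ne_zero (mul_ne_zero hB0 h2) (mul_ne_zero hA0 h3) (by rw [← hμ]; norm_num)
        · rw [show μ ^ 4 = (μ ^ 2) ^ 2 by ring, hμ]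
          field_simp
          linear_combination -hAB
        · rw [show μ ^ 6 = (μ ^ 2) ^ 3 by ring, hμ]
          field_simp
          linear_combination -hAB
  refine ⟨ofUpperHalfPlane μ hμ τ, ?_, ?_⟩
  · rw [g₂_ofUpperHalfPlane, ← hA, ← h4]
    field_simp
  · rw [g₃_ofUpperHalfPlane, ← hB, ← h6]
    field_simp

end PeriodPair

end Uniformization

/-! ### Solutions of the autonomous and the Painlevé equation -/

theorem mainTheorem4 (lam g₂ g₃ : ℂ) (U : Set ℂ) (hUo : IsOpen U) (hUc : IsConnected U)
    (S : ℂ → ℂ) :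
    -- the case `η = κ = 0`, `λ ≠ 0`: the first Painlevé equation for `w = -S'`
    (lam ≠ 0 → IsSigmaSolution 0 0 lam g₂ g₃ U S → ¬ IsAffineOn U S →
      ∀ w : ℂ → ℂ, w = (fun z => -deriv S z) →
        ∀ z ∈ U, AnalyticAt ℂ S z →
          deriv (deriv w) z = 6 * (w z) ^ 2 - lam * z - g₂ / 2) ∧
    -- the case `η = κ = λ = 0`, nonzero discriminant
    (g₂ ^ 3 - 27 * g₃ ^ 2 ≠ 0 →
      (∃ L : PeriodPair, L.g₂ = g₂ ∧ L.g₃ = g₃) ∧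
      ∀ L : PeriodPair, L.g₂ = g₂ → L.g₃ = g₃ →
        ((IsSigmaSolution 0 0 0 g₂ g₃ U S ∧ ¬ IsAffineOn U S) ↔
          ∃ z₀ B : ℂ, S =ᶠ[codiscreteWithin U] fun z => L.weierstrassZeta (z - z₀) + B) ∧
        (∀ z₀ B : ℂ, (S =ᶠ[codiscreteWithin U] fun z => L.weierstrassZeta (z - z₀) + B) →
          (∀ z ∈ U, AnalyticAt ℂ S z → deriv S z = -L.weierstrassP (z - z₀)) ∧
          IsElliptic (fun z => -L.weierstrassP (z - z₀)))) ∧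
    -- the case `η = κ = λ = 0`, zero discriminant
    (g₂ ^ 3 - 27 * g₃ ^ 2 = 0 →
      (∃ k : ℂ, g₂ = 4 / 3 * k ^ 4 ∧ g₃ = -(8 / 27) * k ^ 6) ∧
      ∀ k : ℂ, g₂ = 4 / 3 * k ^ 4 → g₃ = -(8 / 27) * k ^ 6 →
        ((IsSigmaSolution 0 0 0 g₂ g₃ U S ∧ ¬ IsAffineOn U S) ↔
          ∃ z₀ B : ℂ, S =ᶠ[codiscreteWithin U] fun z => degenerateZeta k (z - z₀) + B) ∧
        (∀ z₀ B : ℂ, (S =ᶠ[codiscreteWithin U] fun z => degenerateZeta k (z - z₀) + B) →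
          ∀ z ∈ U, AnalyticAt ℂ S z → deriv S z = -degenerateP k (z - z₀))) := by
  refine ⟨?_, fun hdisc => ⟨PeriodPair.exists_g₂_eq_g₃_eq hdisc, ?_⟩,
    fun hdisc => ⟨exists_invariants_eq_of_discriminant_eq_zero hdisc, ?_⟩⟩
  · rintro - hsol hna w rfl z hz hS
    exact hsol.painleve_one hUo hUc hna hz hS
  · rintro L rfl rfl
    exact ⟨L.isWeierstrassPair.isSigmaSolution_and_not_isAffineOn_iff hUo hUc,
      fun z₀ B hST => ⟨fun z hz hS => L.isWeierstrassPair.deriv_eq_of_eventuallyEq hUo hST hz hS,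
        L.isElliptic_neg_weierstrassP_translate z₀⟩⟩
  · rintro k rfl rfl
    have hpair := isWeierstrassPair_degenerateZeta k
    exact ⟨hpair.isSigmaSolution_and_not_isAffineOn_iff hUo hUc,
      fun z₀ B hST z hz hS => hpair.deriv_eq_of_eventuallyEq hUo hST hz hS⟩
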